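/- Let $\mathcal M$ be a $k$-dimensional closed (compact, without boundary) $C^\infty$ manifold isometrically embedded in $\mathbb R^d$, and let $|\mathcal M|$ denote its $k$-dimensional volume. Let $R:[0,\infty)\to\mathbb R$ be a $C^2$ function such that $R(r)\ge 0$ for all $r\ge 0$, $R(r)=0$ for all $r>1$, and for some $\delta_0>0$, $R(r)\ge\delta_0$ for $0\le r\le 1/2$. For $\delta>0$ and $x,y\in\mathbb R^d$ put $$R_\delta(x,y)=\frac1{(4\pi\delta^2)^{k/2}}\,R\!\left(\frac{|x-y|^2}{4\delta^2}\right),\qquad \mathcal R_\delta=\{R_\delta(x,\cdot):x\in\mathcal M\}.$$ For $P=\{p_1,\dots,p_n\}$ and a continuous function $f$ put $$I(f)=\frac1{|\mathcal M|}\int_{\mathcal M}f(y)\,dy,\qquad I_n(f)=\frac1n\sum_{i=1}^n f(p_i).$$ Then there is a constant $C>0$, depending only on $\mathcal M$ and $R$ (and not on $\delta$, $n$ or $P$), such that for every integer $n\ge 1$ and every $0<\delta\le\sqrt n$ (in particular for every $0<\delta\le 1$): if $p_1,\dots,p_n$ are independent random points uniformly distributed on $\mathcal M$, then with probability at least $1-\frac1{2n}$,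 $$\sup_{f\in\mathcal R_\delta}|I(f)-I_n(f)|\le\frac{C}{\delta^k\sqrt n}\,\bigl(\ln n-2\ln\delta+1\bigr)^{1/2}.$$ -/

import Mathlib

open MeasureTheory ProbabilityTheory Set
open scoped ENNReal ContDiff Manifold

noncomputable section

namespace WNLL

/-- The ambient Euclidean space `ℝ^d`, with the Euclidean norm. -/
abbrev Euc (d : ℕ) : Type := EuclideanSpace ℝ (Fin d)

/-- The conditions on the kernel profile `R : [0, ∞) → ℝ` (the values of the Lean function at
negative arguments play no role): `R` is `C²` on `[0, ∞)` (one-sided at `0`), nonnegative, vanishes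
on `(1, ∞)`, and is bounded below by a positive constant on `[0, 1/2]`. -/
structure IsKernelProfile (R : ℝ → ℝ) : Prop where
  smooth : ContDiffOn ℝ 2 R (Ici 0)
  nonneg : ∀ r, 0 ≤ r → 0 ≤ R r
  compact_support : ∀ r, 1 < r → R r = 0
  nondegenerate : ∃ δ₀ : ℝ, 0 < δ₀ ∧ ∀ r, 0 ≤ r → r ≤ 1 / 2 → δ₀ ≤ R r

/-- The rescaled kernel `R_δ(x, y) = C_δ R(|x - y|² / (4 δ²))`, `C_δ = (4 π δ²)^(-k/2)`. -/
def scaledKernel {d : ℕ} (R : ℝ → ℝ) (k : ℕ) (δ : ℝ) (x y : Euc d) : ℝ :=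
  1 / (4 * Real.pi * δ ^ 2) ^ ((k : ℝ) / 2) * R (‖x - y‖ ^ 2 / (4 * δ ^ 2))

/-- The function class `{R_δ(x, ·) : x ∈ S}`. -/
def kernelClass {d : ℕ} (R : ℝ → ℝ) (k : ℕ) (δ : ℝ) (S : Set (Euc d)) : Set (Euc d → ℝ) :=
  {f | ∃ x ∈ S, f = scaledKernel R k δ x}

/-- `I(f) = |S|⁻¹ ∫_S f`, the normalized integral over a `k`-dimensional submanifold `S` of `ℝ^d`
with respect to its `k`-dimensional volume. The volume measure of `S` (with the metric induced from
`ℝ^d`) is the `k`-dimensional Hausdorff measure, normalized to agree with Lebesgue measure on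
`ℝ^k`. -/
def normalizedIntegral {d : ℕ} (k : ℕ) (S : Set (Euc d)) (f : Euc d → ℝ) : ℝ :=
  ((μHE[k] : Measure (Euc d)).real S)⁻¹ * ∫ y in S, f y ∂(μHE[k] : Measure (Euc d))

/-- `I_n(f) = n⁻¹ ∑ f(p_i)`, the empirical mean over the points `p_1, …, p_n`. -/
def empiricalMean {d n : ℕ} (p : Fin n → Euc d) (f : Euc d → ℝ) : ℝ :=
  1 / (n : ℝ) * ∑ i, f (p i)

/-- `sup_{f ∈ R_δ} |I(f) - I_n(f)|`, as an element of `[0, ∞]`. -/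
def uniformDeviation {d n : ℕ} (R : ℝ → ℝ) (k : ℕ) (δ : ℝ) (S : Set (Euc d))
    (p : Fin n → Euc d) : ℝ≥0∞ :=
  ⨆ f ∈ kernelClass R k δ S, ENNReal.ofReal |normalizedIntegral k S f - empiricalMean p f|

/-- The uniform probability distribution on a `k`-dimensional submanifold `S` of `ℝ^d`: the
`k`-dimensional volume measure restricted to `S` and divided by the volume of `S`. -/
def uniformLaw {d : ℕ} (k : ℕ) (S : Set (Euc d)) : Measure (Euc d) :=
  ProbabilityTheory.cond (μHE[k] : Measure (Euc d)) S

end WNLL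

end

/-! The normalizing factor is at most `1 / δ ^ k`, so it suffices to control the kernels R(|z -
y|²/(4δ²)), which take values in [0, B] and are 2L/δ-Lipschitz in z. Write l = ln n - 2 ln δ. If δ⁴
< n, cover a ball containing the manifold by a grid of m^d points, m ≈ √n/δ. Passing to a grid point
costs O(1/√n), and Hoeffding with a union bound over the grid controls the centres up to
O(√((l+1)/n)): ln(m^d) is at most d(1 + l/2), and ln n ≤ 2l. If δ⁴ ≥ n, this last inequality may
fail, but then each kernel differs from R(0) by only O(1/δ²) = O(1/√n) on the manifold, and the
bound holds almost surely. -/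

namespace WNLL

/-! ### Lipschitz and sup bounds for the kernel profile. -/

namespace IsKernelProfile

variable {R : ℝ → ℝ}

lemma eq_apply_min (hR : IsKernelProfile R) (s : ℝ) : R s = R (min s 2) := by
  rcases le_total s 2 with h | h
  · rw [min_eq_left h]
  · rw [min_eq_right h, hR.compact_support s (by linarith), hR.compact_support 2 (by norm_num)]

/-- The one-sided derivative is bounded on the compact interval [0, 2], and truncating arguments at
2 does not change R. -/
lemma exists_lipschitz (hR : IsKernelProfile R) :
    ∃ L : ℝ, 0 ≤ L ∧ ∀ s t, 0 ≤ s → 0 ≤ t → |R s - R t| ≤ L * |s - t| := by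
  have hc : ContDiffOn ℝ 2 R (Icc 0 2) := hR.smooth.mono Icc_subset_Ici_self
  have hd : ContinuousOn (derivWithin R (Icc 0 2)) (Icc 0 2) :=
    hc.continuousOn_derivWithin (uniqueDiffOn_Icc (by norm_num)) (by norm_num)
  obtain ⟨L, hL⟩ := isCompact_Icc.exists_bound_of_continuousOn hd
  have hL0 : 0 ≤ L := (norm_nonneg _).trans (hL 0 (by norm_num))
  refine ⟨L, hL0, fun s t hs ht => ?_⟩
  rw [hR.eq_apply_min s, hR.eq_apply_min t]
  have h := (convex_Icc (0 : ℝ) 2).norm_image_sub_le_of_norm_derivWithin_le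
    (hc.differentiableOn (by norm_num)) hL
    (x := min t 2) (y := min s 2) ⟨by positivity, min_le_right _ _⟩
    ⟨by positivity, min_le_right _ _⟩
  simp only [Real.norm_eq_abs] at h
  refine h.trans (mul_le_mul_of_nonneg_left ?_ hL0)
  exact abs_inf_sub_inf_le_abs _ _ _

/-- Squaring is not globally Lipschitz, but truncating at 4 is harmless since R vanishes there, and
u²/4 is 2-Lipschitz on [0, 4]. -/
lemma abs_sub_le_of_sq (hR : IsKernelProfile R) {L : ℝ} (hL0 : 0 ≤ L)
    (hL : ∀ s t, 0 ≤ s → 0 ≤ t → |R s - R t| ≤ L * |s - t|) {s t : ℝ} (hs : 0 ≤ s) (ht : 0 ≤ t) :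
    |R (s ^ 2 / 4) - R (t ^ 2 / 4)| ≤ 2 * L * |s - t| := by
  have key : ∀ u : ℝ, 0 ≤ u → R (u ^ 2 / 4) = R ((min u 4) ^ 2 / 4) := by
    intro u hu
    rcases le_total u 4 with h | h
    · rw [min_eq_left h]
    · rw [min_eq_right h, hR.compact_support (u ^ 2 / 4) (by nlinarith),
        hR.compact_support (4 ^ 2 / 4) (by norm_num)]
  rw [key s hs, key t ht]
  have ha : 0 ≤ min s 4 := by positivity
  have hb : 0 ≤ min t 4 := by positivity
  have hab : |min s 4 - min t 4| ≤ |s - t| := abs_inf_sub_inf_le_abs _ _ _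
  refine (hL _ _ (by positivity) (by positivity)).trans ?_
  have e : (min s 4) ^ 2 / 4 - (min t 4) ^ 2 / 4
      = (min s 4 + min t 4) / 4 * (min s 4 - min t 4) := by ring
  have h4 : (min s 4 + min t 4) / 4 ≤ 2 := by
    have := min_le_right s 4
    have := min_le_right t 4
    linarith
  rw [e, abs_mul, abs_of_nonneg (by positivity)]
  calc L * ((min s 4 + min t 4) / 4 * |min s 4 - min t 4|) ≤ L * (2 * |s - t|) := by gcongr
    _ = 2 * L * |s - t| := by ring

/-- Scaling by δ gives a Lipschitz constant of order 1/δ, with no dependence on the diameter. -/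
lemma abs_sub_le_of_norm {E : Type*} [NormedAddCommGroup E] (hR : IsKernelProfile R) {L : ℝ}
    (hL0 : 0 ≤ L) (hL : ∀ s t, 0 ≤ s → 0 ≤ t → |R s - R t| ≤ L * |s - t|) {δ : ℝ} (hδ : 0 < δ)
    (u v : E) :
    |R (‖u‖ ^ 2 / (4 * δ ^ 2)) - R (‖v‖ ^ 2 / (4 * δ ^ 2))| ≤ 2 * L * (‖u - v‖ / δ) := by
  have e : ∀ w : E, ‖w‖ ^ 2 / (4 * δ ^ 2) = (‖w‖ / δ) ^ 2 / 4 := fun w => by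
    field_simp
  rw [e, e]
  refine (hR.abs_sub_le_of_sq hL0 hL (by positivity) (by positivity)).trans ?_
  rw [← sub_div, abs_div, abs_of_pos hδ]
  gcongr
  exact abs_norm_sub_norm_le u v

lemma le_bound (hR : IsKernelProfile R) {L : ℝ} (hL0 : 0 ≤ L)
    (hL : ∀ s t, 0 ≤ s → 0 ≤ t → |R s - R t| ≤ L * |s - t|) {s : ℝ} (hs : 0 ≤ s) :
    R s ≤ R 0 + L * 2 := by
  rw [hR.eq_apply_min s]
  have h0 : 0 ≤ min s 2 := by positivity
  have h := (le_abs_self _).trans (hL (min s 2) 0 h0 le_rfl)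
  rw [sub_zero, abs_of_nonneg h0] at h
  have := mul_le_mul_of_nonneg_left (min_le_right s 2) hL0
  linarith

lemma zero_pos (hR : IsKernelProfile R) : 0 < R 0 := by
  obtain ⟨c, hc, h⟩ := hR.nondegenerate
  exact hc.trans_le (h 0 le_rfl (by norm_num))

end IsKernelProfile

/-! ### Grid nets in Euclidean balls. -/

lemma norm_le_card_mul {d : ℕ} (x : Euc d) {c : ℝ} (hc : 0 ≤ c) (h : ∀ i, |x i| ≤ c) :
    ‖x‖ ≤ d * c := by
  rw [EuclideanSpace.norm_eq]
  refine Real.sqrt_le_iff.2 ⟨by positivity, ?_⟩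
  have hd : (d : ℝ) ≤ (d : ℝ) ^ 2 := by exact_mod_cast Nat.le_self_pow two_ne_zero d
  calc ∑ i, ‖x i‖ ^ 2 ≤ ∑ _i : Fin d, c ^ 2 :=
        Finset.sum_le_sum fun i _ => by
          rw [Real.norm_eq_abs]; exact pow_le_pow_left₀ (abs_nonneg _) (h i) 2
    _ = d * c ^ 2 := by simp
    _ ≤ (d : ℝ) ^ 2 * c ^ 2 := by gcongr
    _ = (d * c) ^ 2 := by ring

/-- A ball of radius `D` in `ℝ^d` has a net of at most `m ^ d` points and mesh `d * (2 * D / m)`. -/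
lemma exists_grid_net (d : ℕ) {D : ℝ} (hD : 0 < D) {m : ℕ} (hm : 1 ≤ m) :
    ∃ T : Finset (Euc d), T.card ≤ m ^ d ∧
      ∀ x : Euc d, ‖x‖ ≤ D → ∃ z ∈ T, ‖x - z‖ ≤ d * (2 * D / m) := by
  classical
  have hm0 : (0 : ℝ) < m := by exact_mod_cast hm
  set η : ℝ := 2 * D / m with hη
  have hη0 : 0 < η := by positivity
  let c : (Fin d → Fin m) → Euc d := fun j => WithLp.toLp 2 fun i => -D + η * (j i : ℕ)
  refine ⟨Finset.univ.image c, ?_, fun x hx => ?_⟩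
  · exact Finset.card_image_le.trans (by simp)
  · have hxi : ∀ i, |x i| ≤ D := fun i => by
      simpa using (PiLp.norm_apply_le x i).trans hx
    -- The cap handles the right endpoint `x i = D`, whose floor `m` is not a valid index.
    let q : Fin d → ℕ := fun i => min ⌊(x i + D) / η⌋₊ (m - 1)
    have hq : ∀ i, q i < m := fun i => by
      have := min_le_right ⌊(x i + D) / η⌋₊ (m - 1)
      simp only [q]; omega
    refine ⟨c fun i => ⟨q i, hq i⟩, Finset.mem_image_of_mem _ (Finset.mem_univ _), ?_⟩
    refine norm_le_card_mul _ hη0.le fun i => ?_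
    have h1 := (abs_le.1 (hxi i)).1
    have h2 := (abs_le.1 (hxi i)).2
    set u : ℝ := (x i + D) / η with hu
    have hxu : x i = -D + η * u := by rw [hu]; field_simp; ring
    have hu0 : 0 ≤ u := div_nonneg (by linarith) hη0.le
    have hum : u ≤ m := by
      rw [hu, div_le_iff₀ hη0, hη]; field_simp; linarith
    have hle : (q i : ℝ) ≤ u :=
      (Nat.cast_le.2 (min_le_left _ _)).trans (Nat.floor_le hu0)
    have hge : u ≤ q i + 1 := by
      rcases le_total ⌊u⌋₊ (m - 1) with h | h
      · have : q i = ⌊u⌋₊ := min_eq_left h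
        rw [this]; exact (Nat.lt_floor_add_one u).le
      · have : q i = m - 1 := min_eq_right h
        rw [this, Nat.cast_sub hm]; simpa using hum
    have e : (x - c fun i => ⟨q i, hq i⟩) i = η * (u - q i) := by
      simp only [c, PiLp.sub_apply, hxu]; ring
    rw [e, abs_of_nonneg (mul_nonneg hη0.le (by linarith))]
    nlinarith

/-! ### Concentration of empirical means. -/

section Deviation

variable {Ω : Type*} [MeasurableSpace Ω] {P : Measure Ω} [IsProbabilityMeasure P]
  {d n : ℕ} {ν : Measure (Euc d)}

lemma empiricalMean_const (hn : 1 ≤ n) (x : Fin n → Euc d) (c : ℝ) :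
    empiricalMean x (fun _ => c) = c := by
  have : (n : ℝ) ≠ 0 := by positivity
  simp [empiricalMean, this]

/-- Two-sided Hoeffding inequality for the empirical mean of a bounded function. -/
lemma measureReal_le_abs_integral_sub_empiricalMean (hn : 1 ≤ n) {p : Fin n → Ω → Euc d}
    (hp : iIndepFun p P) (hl : ∀ i, HasLaw (p i) ν P) {f : Euc d → ℝ} (hf : Measurable f)
    {B : ℝ} (hB : 0 < B) (hfB : ∀ y, f y ∈ Icc 0 B) {t : ℝ} (ht : 0 ≤ t) :
    P.real {w | t ≤ |∫ y, f y ∂ν - empiricalMean (fun i => p i w) f|}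
      ≤ 2 * Real.exp (-(2 * n * t ^ 2 / B ^ 2)) := by
  have hn0 : (0 : ℝ) < n := by exact_mod_cast hn
  set μ := ∫ y, f y ∂ν
  let X : Fin n → Ω → ℝ := fun i w => f (p i w) - μ
  have hsub : ∀ i, HasSubgaussianMGF (X i) ((‖B - 0‖₊ / 2) ^ 2) P := fun i => by
    have h := hasSubgaussianMGF_of_mem_Icc (μ := P) (X := fun w => f (p i w))
      (hf.comp_aemeasurable (hl i).aemeasurable) (Filter.Eventually.of_forall fun w => hfB (p i w))
    have e : ∫ w, f (p i w) ∂P = μ := (hl i).integral_comp hf.aestronglyMeasurable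
    rwa [e] at h
  have hind : iIndepFun X P := hp.comp (fun _ y => f y - μ) fun _ => hf.sub_const _
  have hind' : iIndepFun (fun i => -X i) P := hp.comp (fun _ y => -(f y - μ)) fun _ =>
    (hf.sub_const _).neg
  -- Hoeffding's lemma gives each summand variance proxy (B/2)².
  have hsum : -(n * t) ^ 2 / (2 * ∑ _i : Fin n, (((‖B - 0‖₊ / 2) ^ 2 : NNReal) : ℝ))
      = -(2 * n * t ^ 2 / B ^ 2) := by
    have : (‖B - 0‖) ^ 2 = B ^ 2 := by simp
    simp only [NNReal.coe_pow, NNReal.coe_div, coe_nnnorm, NNReal.coe_ofNat, div_pow, this,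
      Finset.sum_const, Finset.card_univ, Fintype.card_fin, nsmul_eq_mul]
    field_simp
  have h1 := HasSubgaussianMGF.measure_sum_ge_le_of_iIndepFun hind (s := Finset.univ)
    (fun i _ => hsub i) (ε := n * t) (by positivity)
  have h2 := HasSubgaussianMGF.measure_sum_ge_le_of_iIndepFun hind' (s := Finset.univ)
    (fun i _ => (hsub i).neg) (ε := n * t) (by positivity)
  rw [NNReal.coe_sum, hsum] at h1 h2
  have hsub : {w | t ≤ |μ - empiricalMean (fun i => p i w) f|}
      ⊆ {w | n * t ≤ ∑ i, X i w} ∪ {w | n * t ≤ ∑ i, (-X i) w} := by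
    intro w hw
    have e : ∑ i, X i w = n * (empiricalMean (fun i => p i w) f - μ) := by
      simp only [X, empiricalMean, Finset.sum_sub_distrib, Finset.sum_const, Finset.card_univ,
        Fintype.card_fin, nsmul_eq_mul]
      field_simp
    have hw' : t ≤ |μ - empiricalMean (fun i => p i w) f| := hw
    rcases le_abs.1 hw' with h | h
    · right
      simp only [mem_ofPred_eq, Pi.neg_apply, Finset.sum_neg_distrib, e]
      nlinarith
    · left
      simp only [mem_ofPred_eq, e]
      nlinarith
  calc P.real {w | t ≤ |μ - empiricalMean (fun i => p i w) f|}
      ≤ P.real ({w | n * t ≤ ∑ i, X i w} ∪ {w | n * t ≤ ∑ i, (-X i) w}) :=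
        measureReal_mono hsub
    _ ≤ _ := measureReal_union_le _ _
    _ ≤ _ := by linarith

/-- Uniformly close functions have close deviations. -/
lemma abs_integral_sub_empiricalMean_le [IsProbabilityMeasure ν] (hn : 1 ≤ n)
    {f g : Euc d → ℝ} (hf : Integrable f ν)
    (hg : Integrable g ν) {x : Fin n → Euc d} {ε : ℝ} (hν : ∀ᵐ y ∂ν, |f y - g y| ≤ ε)
    (hx : ∀ i, |f (x i) - g (x i)| ≤ ε) :
    |∫ y, f y ∂ν - empiricalMean x f| ≤ |∫ y, g y ∂ν - empiricalMean x g| + 2 * ε := by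
  have hn0 : (0 : ℝ) < n := by exact_mod_cast hn
  have h1 : |∫ y, f y ∂ν - ∫ y, g y ∂ν| ≤ ε := by
    rw [← integral_sub hf hg]
    simpa using norm_integral_le_of_norm_le_const (μ := ν) (f := fun y => f y - g y) hν
  have h2 : |empiricalMean x f - empiricalMean x g| ≤ ε := by
    rw [empiricalMean, empiricalMean, ← mul_sub, ← Finset.sum_sub_distrib, abs_mul,
      abs_of_pos (by positivity)]
    have : |∑ i, (f (x i) - g (x i))| ≤ n * ε :=
      (Finset.abs_sum_le_sum_abs _ _).trans
        ((Finset.sum_le_sum fun i _ => hx i).trans (by simp))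
    calc 1 / (n : ℝ) * |∑ i, (f (x i) - g (x i))| ≤ 1 / (n : ℝ) * (n * ε) := by gcongr
      _ = ε := by field_simp
  rw [abs_le] at h1 h2
  have h3 := le_abs_self (∫ y, g y ∂ν - empiricalMean x g)
  have h4 := neg_abs_le (∫ y, g y ∂ν - empiricalMean x g)
  rw [abs_le]
  constructor <;> linarith

/-- Hoeffding's inequality for finitely many functions simultaneously. -/
lemma measureReal_exists_le_abs_integral_sub_empiricalMean {α : Type*} (hn : 1 ≤ n)
    {p : Fin n → Ω → Euc d} (hp : iIndepFun p P) (hl : ∀ i, HasLaw (p i) ν P)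
    {f : α → Euc d → ℝ} (hf : ∀ a, Measurable (f a)) {B : ℝ} (hB : 0 < B)
    (hfB : ∀ a y, f a y ∈ Icc 0 B) (T : Finset α) {t : ℝ} (ht : 0 ≤ t) :
    P.real {w | ∃ a ∈ T, t ≤ |∫ y, f a y ∂ν - empiricalMean (fun i => p i w) (f a)|}
      ≤ T.card * (2 * Real.exp (-(2 * n * t ^ 2 / B ^ 2))) := by
  have e : {w | ∃ a ∈ T, t ≤ |∫ y, f a y ∂ν - empiricalMean (fun i => p i w) (f a)|}
      = ⋃ a ∈ T, {w | t ≤ |∫ y, f a y ∂ν - empiricalMean (fun i => p i w) (f a)|} := by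
    ext w; simp
  rw [e]
  refine (measureReal_biUnion_finset_le _ _).trans ?_
  refine (Finset.sum_le_sum fun a _ =>
    measureReal_le_abs_integral_sub_empiricalMean hn hp hl (hf a) hB (hfB a) ht).trans ?_
  simp

end Deviation

/-! ### Reduction to unnormalized kernels, and the union-bound count. -/

/-- Subadditivity alone suffices, so the event about the supremum need not be shown measurable. -/
lemma ofReal_one_sub_le_of_compl {Ω : Type*} [MeasurableSpace Ω] {P : Measure Ω}
    [IsProbabilityMeasure P] {A N : Set Ω} {c : ℝ} (hN : P.real N ≤ c) (h : Nᶜ ⊆ A) :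
    ENNReal.ofReal (1 - c) ≤ P A := by
  have h1 : (1 : ℝ) ≤ P.real N + P.real A := by
    have : P.real (N ∪ A) = 1 := by
      have : N ∪ A = univ := by
        rw [eq_univ_iff_forall]
        intro w
        by_cases hw : w ∈ N
        · exact Or.inl hw
        · exact Or.inr (h hw)
      rw [this]; simp
    rw [← this]; exact measureReal_union_le _ _
  refine ENNReal.ofReal_le_of_le_toReal ?_
  change 1 - c ≤ P.real A
  linarith

lemma normalizedIntegral_eq_integral_uniformLaw {d k : ℕ} (S : Set (Euc d)) (f : Euc d → ℝ) :
    normalizedIntegral k S f = ∫ y, f y ∂(uniformLaw k S) := by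
  rw [normalizedIntegral, uniformLaw, ProbabilityTheory.cond, integral_smul_measure,
    ENNReal.toReal_inv, smul_eq_mul]
  rfl

lemma empiricalMean_const_mul {d n : ℕ} (x : Fin n → Euc d) (c : ℝ) (f : Euc d → ℝ) :
    empiricalMean x (fun y => c * f y) = c * empiricalMean x f := by
  simp only [empiricalMean, ← Finset.mul_sum]; ring

lemma normalizing_factor_le {k : ℕ} {δ : ℝ} (hδ : 0 < δ) :
    1 / (4 * Real.pi * δ ^ 2) ^ ((k : ℝ) / 2) ≤ 1 / δ ^ k := by
  have e : (δ ^ 2) ^ ((k : ℝ) / 2) = δ ^ k := by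
    rw [← Real.rpow_natCast δ 2, ← Real.rpow_mul hδ.le, ← Real.rpow_natCast δ k]
    congr 1
    push_cast; ring
  rw [← e]
  refine one_div_le_one_div_of_le (Real.rpow_pos_of_pos (by positivity) _) ?_
  refine Real.rpow_le_rpow (by positivity) ?_ (by positivity)
  nlinarith [Real.pi_gt_three, sq_nonneg δ]

/-- A uniform bound on the deviations of the unnormalized kernels bounds the deviation over the
kernel class. -/
lemma uniformDeviation_le {d n k : ℕ} {R : ℝ → ℝ} {δ : ℝ} (hδ : 0 < δ) {S : Set (Euc d)}
    {x : Fin n → Euc d} {b : ℝ}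
    (h : ∀ z ∈ S, |∫ y, R (‖z - y‖ ^ 2 / (4 * δ ^ 2)) ∂(uniformLaw k S) -
      empiricalMean x (fun y => R (‖z - y‖ ^ 2 / (4 * δ ^ 2)))| ≤ b) :
    uniformDeviation R k δ S x ≤ ENNReal.ofReal (b / δ ^ k) := by
  refine iSup₂_le ?_
  rintro _ ⟨z, hz, rfl⟩
  refine ENNReal.ofReal_le_ofReal ?_
  have hA : 0 ≤ 1 / (4 * Real.pi * δ ^ 2) ^ ((k : ℝ) / 2) := by positivity
  have e : scaledKernel R k δ z = fun y => 1 / (4 * Real.pi * δ ^ 2) ^ ((k : ℝ) / 2) *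
      R (‖z - y‖ ^ 2 / (4 * δ ^ 2)) := rfl
  rw [normalizedIntegral_eq_integral_uniformLaw, e, empiricalMean_const_mul,
    integral_const_mul, ← mul_sub, abs_mul, abs_of_nonneg hA]
  calc _ ≤ 1 / δ ^ k * b :=
        mul_le_mul (normalizing_factor_le hδ) (h z hz) (abs_nonneg _) (by positivity)
    _ = b / δ ^ k := by ring

/-- In logarithms: 2 ln 2 + ln n + d ln m ≤ 2 + 2l + d(1 + l/2) ≤ 2(2+d)(l+1). The hypothesis δ⁴ < n
is what gives ln n ≤ 2l. -/
lemma card_mul_exp_le {d n m : ℕ} {δ l : ℝ} (hn : 1 ≤ n) (hδ : 0 < δ)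
    (hδ4 : δ ^ 4 < n) (hm1 : 1 ≤ m) (hm : (m : ℝ) ≤ 2 * (√(n : ℝ) / δ))
    (hl : l = Real.log n - 2 * Real.log δ) :
    ((m ^ d : ℕ) : ℝ) * (2 * Real.exp (-(2 * ((2 + d) * (l + 1))))) ≤ 1 / (2 * (n : ℝ)) := by
  have hn0 : (0 : ℝ) < n := by exact_mod_cast hn
  have hm0 : (0 : ℝ) < m := by exact_mod_cast hm1
  have hlogn : 0 ≤ Real.log n := Real.log_nonneg (by exact_mod_cast hn)
  have h4 : 4 * Real.log δ ≤ Real.log n := by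
    have := Real.log_le_log (by positivity) hδ4.le
    rwa [Real.log_pow] at this
  have hl0 : 0 ≤ l := by rw [hl]; linarith
  have hnl : Real.log n ≤ 2 * l := by rw [hl]; linarith
  have hlog2 : Real.log 2 ≤ 1 := by linarith [Real.log_two_lt_d9]
  have hlogm : Real.log m ≤ 1 + l / 2 := by
    have := Real.log_le_log hm0 hm
    rw [Real.log_mul (by norm_num) (by positivity), Real.log_div (by positivity) hδ.ne',
      Real.log_sqrt hn0.le] at this
    rw [hl]; linarith
  have hmd : ((m ^ d : ℕ) : ℝ) = Real.exp (d * Real.log m) := by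
    rw [mul_comm, Real.exp_mul, Real.exp_log hm0]; simp
  have hlog4 : Real.exp (2 * Real.log 2) = 4 := by
    rw [mul_comm, Real.exp_mul, Real.exp_log (by norm_num)]; norm_num
  rw [le_div_iff₀ (by positivity), hmd]
  calc Real.exp (d * Real.log m) * (2 * Real.exp (-(2 * ((2 + d) * (l + 1))))) * (2 * n)
      = Real.exp (2 * Real.log 2) * Real.exp (Real.log n) * Real.exp (d * Real.log m) *
        Real.exp (-(2 * ((2 + d) * (l + 1)))) := by
        rw [hlog4, Real.exp_log hn0]; ring
    _ = Real.exp (2 * Real.log 2 + Real.log n + d * Real.log m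
        + -(2 * ((2 + d) * (l + 1)))) := by simp only [Real.exp_add]
    _ ≤ Real.exp 0 := by
        refine Real.exp_le_exp.2 ?_
        have hd : (d : ℝ) * Real.log m ≤ d * (1 + l / 2) := by gcongr
        have : 0 ≤ (d : ℝ) * l := by positivity
        have : 0 ≤ (d : ℝ) := by positivity
        nlinarith
    _ = 1 := Real.exp_zero

end WNLL

/-! ### Assembly of the two regimes of δ. -/

theorem theorem4 {d k : ℕ} {M : Type*} [TopologicalSpace M]
    [ChartedSpace (EuclideanSpace ℝ (Fin k)) M] [IsManifold (𝓡 k) ∞ M]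
    [CompactSpace M] [Nonempty M]
    (ι : M → WNLL.Euc d) (hι : Manifold.IsSmoothEmbedding (𝓡 k) (𝓡 d) ∞ ι)
    (R : ℝ → ℝ) (hR : WNLL.IsKernelProfile R) :
    ∃ C : ℝ, 0 < C ∧
      ∀ (n : ℕ), 1 ≤ n → ∀ (δ : ℝ), 0 < δ → δ ≤ √(n : ℝ) →
      ∀ (Ω : Type*) [MeasurableSpace Ω] (P : Measure Ω) [IsProbabilityMeasure P]
        (p : Fin n → Ω → WNLL.Euc d),
        iIndepFun p P → (∀ i, HasLaw (p i) (WNLL.uniformLaw k (range ι)) P) →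
        ENNReal.ofReal (1 - 1 / (2 * (n : ℝ))) ≤
          P {w | WNLL.uniformDeviation R k δ (range ι) (fun i => p i w) ≤
            ENNReal.ofReal (C / (δ ^ k * √(n : ℝ)) *
              (Real.log n - 2 * Real.log δ + 1) ^ ((1 : ℝ) / 2))} := by
  have hcomp : IsCompact (range ι) := isCompact_range hι.isEmbedding.continuous
  obtain ⟨D, hD, hSD⟩ : ∃ D : ℝ, 0 < D ∧ ∀ x ∈ range ι, ‖x‖ ≤ D := by
    obtain ⟨D, hD⟩ := hcomp.isBounded.exists_norm_le
    exact ⟨max D 1, by positivity, fun x hx => (hD x hx).trans (le_max_left _ _)⟩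
  generalize range ι = S at hcomp hSD ⊢
  obtain ⟨L, hL0, hL⟩ := hR.exists_lipschitz
  set B : ℝ := R 0 + L * 2 with hBdef
  have hB : 0 < B := by have := hR.zero_pos; positivity
  have hgB : ∀ δ (z y : WNLL.Euc d), R (‖z - y‖ ^ 2 / (4 * δ ^ 2)) ∈ Icc 0 B := fun δ z y =>
    ⟨hR.nonneg _ (by positivity), hR.le_bound hL0 hL (by positivity)⟩
  -- The summands pay for the Hoeffding threshold, the grid error and the large-δ regime; the 1 is
  -- slack.
  refine ⟨B * √(2 + d) + 8 * L * D * d + 2 * L * D ^ 2 + 1, by positivity, ?_⟩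
  intro n hn δ hδ hδn Ω _ P _ p hp hl
  have hn0 : (0 : ℝ) < n := by exact_mod_cast hn
  have hsn : 0 < √(n : ℝ) := Real.sqrt_pos.2 hn0
  -- Read off from the law of a sample point, with no appeal to the volume being positive and
  -- finite.
  have hprob : IsProbabilityMeasure (WNLL.uniformLaw k S) :=
    (hl ⟨0, hn⟩).isProbabilityMeasure_iff.1 inferInstance
  have hgc : ∀ z : WNLL.Euc d, Continuous fun y => R (‖z - y‖ ^ 2 / (4 * δ ^ 2)) := by
    intro z
    refine (LipschitzWith.of_dist_le_mul (K := ⟨2 * L / δ, by positivity⟩)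
      fun y y' => ?_).continuous
    rw [Real.dist_eq]
    refine (hR.abs_sub_le_of_norm hL0 hL hδ _ _).trans_eq ?_
    rw [sub_sub_sub_cancel_left, dist_comm, dist_eq_norm]
    change _ = 2 * L / δ * _
    ring
  have hgi : ∀ z : WNLL.Euc d, Integrable (fun y => R (‖z - y‖ ^ 2 / (4 * δ ^ 2)))
      (WNLL.uniformLaw k S) := fun z =>
    Integrable.of_mem_Icc 0 B (hgc z).measurable.aemeasurable
      (Filter.Eventually.of_forall fun y => hgB δ z y)
  set l : ℝ := Real.log n - 2 * Real.log δ with hldef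
  have hl0 : 0 ≤ l := by
    have := Real.log_le_log hδ hδn
    rw [Real.log_sqrt hn0.le] at this
    rw [hldef]; linarith
  rw [← Real.sqrt_eq_rpow]
  -- This lets the logarithmic factor absorb errors that are merely O(1/√n).
  have hs1 : 1 ≤ √(l + 1) := Real.one_le_sqrt.2 (by linarith)
  -- It suffices to bound the deviations of the unnormalized kernels.
  have hfinal : ∀ w, ∀ b : ℝ, b ≤ (B * √(2 + d) + 8 * L * D * d + 2 * L * D ^ 2) *
      √(l + 1) / √(n : ℝ) → (∀ z ∈ S, |∫ y, R (‖z - y‖ ^ 2 / (4 * δ ^ 2)) ∂(WNLL.uniformLaw k S) -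
      WNLL.empiricalMean (fun i => p i w) (fun y => R (‖z - y‖ ^ 2 / (4 * δ ^ 2)))| ≤ b) →
      WNLL.uniformDeviation R k δ S (fun i => p i w) ≤
        ENNReal.ofReal ((B * √(2 + d) + 8 * L * D * d + 2 * L * D ^ 2 + 1) /
          (δ ^ k * √(n : ℝ)) * √(l + 1)) := by
    intro w b hb h
    refine (WNLL.uniformDeviation_le hδ h).trans (ENNReal.ofReal_le_ofReal ?_)
    calc b / δ ^ k ≤ (B * √(2 + d) + 8 * L * D * d + 2 * L * D ^ 2 + 1) *
          √(l + 1) / √(n : ℝ) / δ ^ k := by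
          refine div_le_div_of_nonneg_right (hb.trans ?_) (by positivity)
          gcongr ?_ * _ / _
          linarith
      _ = _ := by field_simp
  rcases lt_or_ge (δ ^ 4) (n : ℝ) with hδ4 | hδ4
  · set m : ℕ := ⌈√(n : ℝ) / δ⌉₊ with hmdef
    have hq1 : 1 ≤ √(n : ℝ) / δ := (one_le_div hδ).2 hδn
    have hm1 : 1 ≤ m := Nat.one_le_ceil_iff.2 (by linarith)
    have hm0 : (0 : ℝ) < m := by exact_mod_cast hm1
    have hmge : √(n : ℝ) / δ ≤ m := Nat.le_ceil _
    have hmle : (m : ℝ) ≤ 2 * (√(n : ℝ) / δ) := by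
      have := (Nat.ceil_lt_add_one (by linarith : 0 ≤ √(n : ℝ) / δ)).le
      rw [← hmdef] at this
      linarith
    obtain ⟨T, hTc, hT⟩ := WNLL.exists_grid_net d hD hm1
    -- Chosen so that the Hoeffding exponent is exactly 2(2+d)(l+1).
    set t : ℝ := B * √((2 + d) * (l + 1) / n) with htdef
    have ht : 0 ≤ t := by positivity
    have hexp : 2 * n * t ^ 2 / B ^ 2 = 2 * ((2 + d) * (l + 1)) := by
      rw [htdef, mul_pow, Real.sq_sqrt (by positivity)]
      field_simp
    have hbad := WNLL.measureReal_exists_le_abs_integral_sub_empiricalMean hn hp hl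
      (f := fun z y => R (‖z - y‖ ^ 2 / (4 * δ ^ 2))) (fun z => (hgc z).measurable) hB
      (fun z y => hgB δ z y) T ht
    rw [hexp] at hbad
    refine WNLL.ofReal_one_sub_le_of_compl (hbad.trans ?_) ?_
    · refine le_trans ?_ (WNLL.card_mul_exp_le (d := d) hn hδ hδ4 hm1 hmle hldef)
      gcongr
    · intro w hw
      simp only [mem_compl_iff, mem_ofPred_eq, not_exists, not_and, not_le] at hw
      refine hfinal w (t + 2 * (2 * L * ((d * (2 * D / m)) / δ))) ?_ ?_
      · have h1 : t = B * √(2 + d) * √(l + 1) / √(n : ℝ) := by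
          rw [htdef, Real.sqrt_div (by positivity), Real.sqrt_mul (by positivity)]; ring
        have h2 : 1 / (m * δ) ≤ 1 / √(n : ℝ) :=
          one_div_le_one_div_of_le hsn ((div_le_iff₀ hδ).1 hmge)
        have h3 : 2 * (2 * L * ((d * (2 * D / m)) / δ)) ≤
            8 * L * D * d * √(l + 1) / √(n : ℝ) := by
          calc 2 * (2 * L * ((d * (2 * D / m)) / δ)) = 8 * L * D * d * (1 / (m * δ)) := by
                field_simp; ring
            _ ≤ 8 * L * D * d * (1 / √(n : ℝ)) := by gcongr
            _ = 8 * L * D * d * 1 / √(n : ℝ) := by ring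
            _ ≤ _ := by gcongr
        have h4 : 0 ≤ 2 * L * D ^ 2 * √(l + 1) / √(n : ℝ) := by positivity
        calc _ ≤ B * √(2 + d) * √(l + 1) / √(n : ℝ) + 8 * L * D * d * √(l + 1) / √(n : ℝ)
              + 2 * L * D ^ 2 * √(l + 1) / √(n : ℝ) := by linarith
          _ = _ := by ring
      -- Grid points may lie off the manifold, which is harmless: the Hoeffding bound holds for any
      -- centre.
      · intro z hz
        obtain ⟨a, haT, ha⟩ := hT z (hSD z hz)
        have hclose : ∀ y, |R (‖z - y‖ ^ 2 / (4 * δ ^ 2)) - R (‖a - y‖ ^ 2 / (4 * δ ^ 2))|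
            ≤ 2 * L * ((d * (2 * D / m)) / δ) := fun y => by
          refine (hR.abs_sub_le_of_norm hL0 hL hδ _ _).trans ?_
          rw [sub_sub_sub_cancel_right]
          gcongr
        refine (WNLL.abs_integral_sub_empiricalMean_le hn (hgi z) (hgi a)
          (Filter.Eventually.of_forall hclose) fun i => hclose _).trans ?_
        have := hw a haT
        linarith
  · have hνS : ∀ᵐ y ∂(WNLL.uniformLaw k S), y ∈ S := by
      rw [WNLL.uniformLaw]
      exact ProbabilityTheory.ae_cond_mem hcomp.measurableSet
    have hpS : ∀ᵐ w ∂P, ∀ i, p i w ∈ S := ae_all_iff.2 fun i =>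
      ((hl i).ae_iff (p := (· ∈ S)) hcomp.measurableSet.mem).2 hνS
    have hδ2 : √(n : ℝ) ≤ δ ^ 2 := by
      rw [Real.sqrt_le_iff]; exact ⟨by positivity, by linarith⟩
    -- The only exceptional event is the null set where some sample point misses the manifold.
    refine WNLL.ofReal_one_sub_le_of_compl (N := {w | ¬ ∀ i, p i w ∈ S}) ?_ ?_
    · have : P.real {w | ¬ ∀ i, p i w ∈ S} = 0 := by
        rw [measureReal_def, ae_iff.1 hpS]; simp
      rw [this]; positivity
    · intro w hw
      have hw' : ∀ i, p i w ∈ S := not_not.1 hw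
      refine hfinal w (2 * (L * (D ^ 2 / δ ^ 2))) ?_ fun z hz => ?_
      · calc 2 * (L * (D ^ 2 / δ ^ 2)) ≤ 2 * (L * (D ^ 2 / √(n : ℝ))) := by gcongr
          _ = 2 * L * D ^ 2 * 1 / √(n : ℝ) := by ring
          _ ≤ _ := by
            gcongr
            have : 0 ≤ B * √(2 + d) + 8 * L * D * d := by positivity
            linarith
      · have hclose : ∀ y ∈ S, |R (‖z - y‖ ^ 2 / (4 * δ ^ 2)) - R 0| ≤ L * (D ^ 2 / δ ^ 2) := by
          intro y hy
          refine (hL _ _ (by positivity) le_rfl).trans ?_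
          have hzy : ‖z - y‖ ≤ 2 * D := (norm_sub_le z y).trans (by linarith [hSD z hz, hSD y hy])
          rw [sub_zero, abs_of_nonneg (by positivity)]
          calc L * (‖z - y‖ ^ 2 / (4 * δ ^ 2)) ≤ L * ((2 * D) ^ 2 / (4 * δ ^ 2)) := by gcongr
            _ = L * (D ^ 2 / δ ^ 2) := by field_simp; norm_num
        refine (WNLL.abs_integral_sub_empiricalMean_le hn (g := fun _ => R 0) (hgi z)
          (integrable_const _) (hνS.mono hclose) fun i => hclose _ (hw' i)).trans ?_
        rw [WNLL.empiricalMean_const hn]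
        simp
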